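/- Let $m\in\mathbb N$ and let $\mathbb R^m$ carry the Euclidean norm. Let $f:\mathbb R^m\to\mathbb R\cup\{+\infty\}$ be proper and lower semicontinuous, and let $g:\mathbb R^m\to\mathbb R$ be differentiable with $\|\nabla g(u)-\nabla g(v)\|\le L_g\|u-v\|$ for all $u,v\in\mathbb R^m$, where $L_g\ge 0$. Let $(\alpha_n)_{n\in\mathbb N},(\beta_n)_{n\in\mathbb N}$ be real sequences with $\alpha_n\to\alpha$ and $\beta_n\to\beta\in\mathbb R$, let $s>0$, let $x_{-1}=x_0\in\mathbb R^m$, and for all $n\in\mathbb N$ let $$y_n=x_n+\alpha_n(x_n-x_{n-1}),\qquad z_n=x_n+\beta_n(x_n-x_{n-1}).$$ Suppose that the sequence $(x_n)_{n\in\mathbb N}$ is generated by one of the following two schemes (in the step size bounds a quotient with $L_g=0$ is read as $+\infty$): * (PADISNO) $f$ is bounded from below, $\alpha\in(-\frac12,\frac12)$, $0<s<\frac{1-2|\alpha|}{L_g(2|\beta|+1)}$, and $x_{n+1}\in\operatorname{argmin}_{u\in\mathbb R^m}\{f(u)+\langle\nabla g(z_n),u-y_n\rangle+\frac1{2s}\|u-y_n\|^2\}$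 for all $n\in\mathbb N$; * (c-PADISNO) $f$ is convex, $\alpha\in(-1,1)$, $0<s<\frac{2(1-|\alpha|)}{L_g(2|\beta|+1)}$, and $x_{n+1}=\operatorname{prox}_{sf}(y_n-s\nabla g(z_n))$ for all $n\in\mathbb N$, where $\operatorname{prox}_{sf}(u)=\operatorname{argmin}_{v\in\mathbb R^m}\{f(v)+\frac1{2s}\|v-u\|^2\}$. For a proper lower semicontinuous $F:\mathbb R^m\to\mathbb R\cup\{+\infty\}$ let $\partial F$ denote the limiting (Mordukhovich) subdifferential: $\partial F(u)=\emptyset$ if $F(u)=+\infty$, and otherwise $\partial F(u)$ is the set of limits of sequences $v_k\in\hat\partial F(u_k)$ with $u_k\to u$, $F(u_k)\to F(u)$, where $\hat\partial F(u)=\{v:\liminf_{w\to u,\,w\ne u}\frac{F(w)-F(u)-\langle v,w-u\rangle}{\|w-u\|}\ge0\}$ if $F(u)<+\infty$ and $\hat\partial F(u)=\emptyset$ otherwise. We say that $F$ has the Kurdyka-Łojasiewicz (KL) property at $\overline x$ with exponent $\theta\in[0,1)$ if $\partial F(\overline x)\ne\emptyset$ and there exist $K,\varepsilon>0$ and $\eta\in(0,+\infty]$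 such that $\operatorname{dist}(0,\partial F(u))\ge\frac1K(F(u)-F(\overline x))^\theta$ whenever $\|u-\overline x\|\le\varepsilon$ and $F(\overline x)<F(u)<F(\overline x)+\eta$ (with $\operatorname{dist}(0,\emptyset)=+\infty$). Assume that $f+g$ is bounded from below, that $x^*$ is a cluster point of $(x_n)_{n\in\mathbb N}$, and that $f+g$ has the KL property at $x^*$ with exponent $\theta\in[\frac12,1)$. Then the following hold. * If $\theta=\frac12$, then there exist $a_1>0$, $Q\in[0,1)$ and $\overline N\in\mathbb N$ such that for all $n\ge\overline N$ $$(f+g)(x_n)-(f+g)(x^*)\le a_1Q^n,\quad \|x_n-x^*\|\le a_1Q^{\frac n2},\quad \|y_n-x^*\|\le a_1Q^{\frac n2},\quad \|z_n-x^*\|\le a_1Q^{\frac n2}.$$ * If $\theta\in(\frac12,1)$, then there exist $a_2>0$ and $\overline N\in\mathbb N$ such that for all $n\ge\overline N$ $$(f+g)(x_n)-(f+g)(x^*)\le a_2n^{-\frac1{2\theta-1}},\quad \|x_n-x^*\|\le a_2n^{\frac{\theta-1}{2\theta-1}},\quad \|y_n-x^*\|\le a_2n^{\frac{\theta-1}{2\theta-1}},\quad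 \|z_n-x^*\|\le a_2n^{\frac{\theta-1}{2\theta-1}}.$$ -/

import Mathlib

open Filter Topology
open scoped NNReal

noncomputable section

namespace Padisno

section Subdifferential

variable {V : Type*} [NormedAddCommGroup V] [InnerProductSpace ℝ V]

/-- The Fréchet subdifferential of an extended-real-valued function at `x`; it is empty when `x`
is outside the domain `{F < +∞}`. The lower limit is over `y → x`, `y ≠ x`, taken in `EReal`. -/
def frechetSubdiff (F : V → EReal) (x : V) : Set V :=
  {v | F x < ⊤ ∧
    0 ≤ liminf (fun y => (F y - F x - ((inner ℝ v (y - x) : ℝ) : EReal)) / ((‖y - x‖ : ℝ) : EReal))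
      (𝓝[≠] x)}

/-- The limiting (Mordukhovich) subdifferential; it is empty outside the domain. -/
def limitingSubdiff (F : V → EReal) (x : V) : Set V :=
  {v | F x < ⊤ ∧ ∃ (p : ℕ → V) (w : ℕ → V),
    Tendsto p atTop (𝓝 x) ∧ Tendsto (fun k => F (p k)) atTop (𝓝 (F x)) ∧
    (∀ k, w k ∈ frechetSubdiff F (p k)) ∧ Tendsto w atTop (𝓝 v)}

/-- `F` has the Kurdyka-Łojasiewicz property at `xbar ∈ dom ∂F` with exponent `θ`:
`dist (0, ∂F x) ≥ (1 / K) (F x - F xbar) ^ θ` for all `x` with `‖x - xbar‖ ≤ ε` and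
`F xbar < F x < F xbar + η`, for some `K, ε > 0` and `η ∈ (0, +∞]`.
The distance is `[0, +∞]`-valued, so that the distance to the empty set is `+∞`; the difference
of the two values of `F` is a difference of real numbers. -/
def HasKLExponentAt (F : V → EReal) (xbar : V) (θ : ℝ) : Prop :=
  (limitingSubdiff F xbar).Nonempty ∧
  ∃ (K ε : ℝ) (η : EReal), 0 < K ∧ 0 < ε ∧ 0 < η ∧
    ∀ x : V, ‖x - xbar‖ ≤ ε → F xbar < F x → F x < F xbar + η →
      ENNReal.ofReal ((1 / K) * ((F x).toReal - (F xbar).toReal) ^ θ)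
        ≤ Metric.infEDist 0 (limitingSubdiff F x)

end Subdifferential

variable {m : ℕ}

/-- The data of the problem `inf (f + g)` on `ℝ^m`: `f` is proper and lower semicontinuous with
values in `ℝ ∪ {+∞}`, and `g` is differentiable with `L`-Lipschitz gradient. -/
structure IsProblem (f : EuclideanSpace ℝ (Fin m) → EReal) (g : EuclideanSpace ℝ (Fin m) → ℝ)
    (L : ℝ≥0) : Prop where
  ne_bot : ∀ u, f u ≠ ⊥
  proper : ∃ u, f u < ⊤
  lsc : LowerSemicontinuous f
  differentiable : Differentiable ℝ g
  lipschitz_gradient : LipschitzWith L (gradient g)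

/-- The objective function `f + g`. -/
def objective (f : EuclideanSpace ℝ (Fin m) → EReal) (g : EuclideanSpace ℝ (Fin m) → ℝ) :
    EuclideanSpace ℝ (Fin m) → EReal :=
  fun u => f u + (g u : EReal)

def BoundedFromBelow (F : EuclideanSpace ℝ (Fin m) → EReal) : Prop :=
  ∃ c : ℝ, ∀ u, (c : EReal) ≤ F u

/-- Convexity of a function with values in `ℝ ∪ {+∞}`. -/
def IsConvex (F : EuclideanSpace ℝ (Fin m) → EReal) : Prop :=
  ∀ u v : EuclideanSpace ℝ (Fin m), ∀ a b : ℝ, 0 < a → 0 < b → a + b = 1 →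
    F (a • u + b • v) ≤ (a : EReal) * F u + (b : EReal) * F v

/-- The inertial step `x_n + γ_n (x_n - x_{n-1})`. Since `0 - 1 = 0` in `ℕ`, the value at `n = 0`
is the one given by the convention `x_{-1} = x_0`. -/
def inertialStep (γ : ℕ → ℝ) (x : ℕ → EuclideanSpace ℝ (Fin m)) (n : ℕ) :
    EuclideanSpace ℝ (Fin m) :=
  x n + γ n • (x n - x (n - 1))

/-- `p` is the value at `u` of the proximal operator of `s f`, i.e. a minimizer of
`v ↦ f v + ‖v - u‖ ^ 2 / (2 s)` (for proper, lower semicontinuous and convex `f` there is exactly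
one). -/
def IsProx (s : ℝ) (f : EuclideanSpace ℝ (Fin m) → EReal) (u p : EuclideanSpace ℝ (Fin m)) :
    Prop :=
  ∀ v, f p + ((1 / (2 * s) * ‖p - u‖ ^ 2 : ℝ) : EReal)
    ≤ f v + ((1 / (2 * s) * ‖v - u‖ ^ 2 : ℝ) : EReal)

/-- The sequences `x, y, z` are generated by PADISNO, under the assumptions on `f` and on the
parameters that belong to it. The step size condition `s < (1 - 2|a|) / (L (2|b| + 1))` is written
without the quotient, so that for `L = 0` the bound is `+∞`. -/
structure IsPADISNO (f : EuclideanSpace ℝ (Fin m) → EReal) (g : EuclideanSpace ℝ (Fin m) → ℝ)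
    (L : ℝ≥0) (α β : ℕ → ℝ) (s : ℝ) (x y z : ℕ → EuclideanSpace ℝ (Fin m)) : Prop where
  bounded_below : BoundedFromBelow f
  parameters : ∃ a b : ℝ, Tendsto α atTop (𝓝 a) ∧ Tendsto β atTop (𝓝 b) ∧
    a ∈ Set.Ioo (-(1 / 2) : ℝ) (1 / 2) ∧ 0 < s ∧ s * ((L : ℝ) * (2 * |b| + 1)) < 1 - 2 * |a|
  y_eq : ∀ n, y n = inertialStep α x n
  z_eq : ∀ n, z n = inertialStep β x n
  x_argmin : ∀ n, ∀ v,
    f (x (n + 1)) + ((inner ℝ (gradient g (z n)) (x (n + 1) - y n)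
        + 1 / (2 * s) * ‖x (n + 1) - y n‖ ^ 2 : ℝ) : EReal)
      ≤ f v + ((inner ℝ (gradient g (z n)) (v - y n) + 1 / (2 * s) * ‖v - y n‖ ^ 2 : ℝ) : EReal)

/-- The sequences `x, y, z` are generated by c-PADISNO, under the assumptions on `f` and on the
parameters that belong to it. The step size condition `s < 2 (1 - |a|) / (L (2|b| + 1))` is written
without the quotient, so that for `L = 0` the bound is `+∞`. -/
structure IsConvexPADISNO (f : EuclideanSpace ℝ (Fin m) → EReal)
    (g : EuclideanSpace ℝ (Fin m) → ℝ) (L : ℝ≥0) (α β : ℕ → ℝ) (s : ℝ)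
    (x y z : ℕ → EuclideanSpace ℝ (Fin m)) : Prop where
  convex : IsConvex f
  parameters : ∃ a b : ℝ, Tendsto α atTop (𝓝 a) ∧ Tendsto β atTop (𝓝 b) ∧
    a ∈ Set.Ioo (-1 : ℝ) 1 ∧ 0 < s ∧ s * ((L : ℝ) * (2 * |b| + 1)) < 2 * (1 - |a|)
  y_eq : ∀ n, y n = inertialStep α x n
  z_eq : ∀ n, z n = inertialStep β x n
  x_prox : ∀ n, IsProx s f (y n - s • gradient g (z n)) (x (n + 1))

/-- `p` is a cluster point of the sequence `x`: the limit of some subsequence. -/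
def IsSeqClusterPt (x : ℕ → EuclideanSpace ℝ (Fin m)) (p : EuclideanSpace ℝ (Fin m)) : Prop :=
  ∃ φ : ℕ → ℕ, StrictMono φ ∧ Tendsto (fun k => x (φ k)) atTop (𝓝 p)

end Padisno

end

/-! Write `F = f + g` and `d_n = ‖x (n + 1) - x n‖`. Both schemes minimize the same proximal model;
the convex one adds quadratic growth. With `k = 1` (PADISNO) or `k = 2` (c-PADISNO), both step size
bounds read `s L (2|b| + 1) + 2|a| < k`.

Testing minimality at the previous iterate and using the descent lemma, the energy `e_n = F (x (n +
1)) - F xstar + C d_n²` drops by at least a multiple of `(d_n + d_{n+1})²`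
(`IsProximalStep.exists_energy`). Optimality supplies a subgradient of `F` at `x (n + 2)` of norm at
most a multiple of `d_n + d_{n+1}`. As `θ ≥ 1/2`, the extra term satisfies `(C d²)^θ ≤ C^θ d` for `d
≤ 1`, so the KL inequality for `F` alone gives `e_{n+1}^θ ≤ E (d_n + d_{n+1})`.

Together these yield `e_{n+1} + κ e_{n+1}^{2θ} ≤ e_n`, hence geometric decay for `θ = 1/2` and
polynomial decay for `θ > 1/2`. The finite-length argument in `exists_rate_of_descent` keeps the
iterates where KL applies and bounds their distance to `xstar` by a multiple of `e_n^{1-θ}`. -/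

namespace Padisno

/-! ### Recursive inequalities for real sequences. -/

section RealSequences

theorem exists_le_geometric {h : ℕ → ℝ} {κ : ℝ} {N : ℕ} (hκ : 0 < κ) (h0 : ∀ n, N ≤ n → 0 ≤ h n)
    (hstep : ∀ n, N ≤ n → h (n + 1) + κ * h (n + 1) ≤ h n) :
    ∃ C : ℝ, 0 < C ∧ ∀ n, N ≤ n → h n ≤ C * (1 / (1 + κ)) ^ n := by
  have hQ : 0 < 1 / (1 + κ) := by positivity
  refine ⟨(h N + 1) / (1 / (1 + κ)) ^ N, by have := h0 N le_rfl; positivity, fun n hn => ?_⟩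
  induction n, hn using Nat.le_induction with
  | base => rw [div_mul_cancel₀ _ (by positivity)]; linarith
  | succ n hn ih =>
    have h1 := hstep n hn
    have h2 : h (n + 1) ≤ h n * (1 / (1 + κ)) := by
      rw [mul_one_div, le_div_iff₀ (by positivity)]; linarith
    calc h (n + 1) ≤ h n * (1 / (1 + κ)) := h2
      _ ≤ ((h N + 1) / (1 / (1 + κ)) ^ N * (1 / (1 + κ)) ^ n) * (1 / (1 + κ)) := by gcongr
      _ = _ := by rw [pow_succ]; ring

/-- A Bernoulli inequality covering `q < 1` too, at the price of the factor `1/2`: `log (1 + u) ≥ u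
/ (1 + u) ≥ u / 2` on `[0, 1]`. -/
theorem one_add_mul_le_rpow {u q : ℝ} (hu : 0 ≤ u) (hu1 : u ≤ 1) (hq : 0 ≤ q) :
    1 + q / 2 * u ≤ (1 + u) ^ q := by
  have h1 : 1 - (1 + u)⁻¹ ≤ Real.log (1 + u) := Real.one_sub_inv_le_log_of_pos (by linarith)
  have h2 : u / 2 ≤ 1 - (1 + u)⁻¹ := by
    have : 1 - (1 + u)⁻¹ = u / (1 + u) := by field_simp; ring
    rw [this]
    gcongr; linarith
  rw [Real.rpow_def_of_pos (by linarith)]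
  have h3 := Real.add_one_le_exp (Real.log (1 + u) * q)
  nlinarith

/-- Raising the recursion to the power `q` makes it quadratic: `r = h ^ q` satisfies `r_{n+1} (1 + c
r_{n+1}) ≤ r_n`, whose solutions decay like `1 / n`. No reciprocals are taken, so `h` may vanish. -/
theorem exists_le_rpow_neg {h : ℕ → ℝ} {κ q : ℝ} {N : ℕ} (hκ : 0 < κ) (hq : 0 < q)
    (h0 : ∀ n, N ≤ n → 0 ≤ h n) (hlim : Tendsto h atTop (𝓝 0))
    (hstep : ∀ n, N ≤ n → h (n + 1) + κ * h (n + 1) ^ (1 + q) ≤ h n) :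
    ∃ C : ℝ, 0 < C ∧ ∃ N' : ℕ, ∀ n, N' ≤ n → h n ≤ C * (n : ℝ) ^ (-(1 / q)) := by
  have hr : Tendsto (fun n => h n ^ q) atTop (𝓝 0) := by
    have := hlim.rpow_const (p := q) (Or.inr hq.le)
    rwa [Real.zero_rpow hq.ne'] at this
  obtain ⟨c, hc, hcdef⟩ : ∃ c : ℝ, 0 < c ∧ c = q / 2 * κ := ⟨_, by positivity, rfl⟩
  have hev : ∀ᶠ n in atTop, h n ^ q ≤ 1 / κ ∧ h n ^ q ≤ 1 / c :=
    (hr.eventually_le_const (by positivity)).and (hr.eventually_le_const (by positivity))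
  obtain ⟨N₁, hN₁⟩ := eventually_atTop.1 hev
  set P := max N N₁ with hP
  have hrec : ∀ n, P ≤ n → h (n + 1) ^ q * (1 + c * h (n + 1) ^ q) ≤ h n ^ q := by
    intro n hn
    have hnN : N ≤ n := le_trans (le_max_left _ _) hn
    have hnN₁ : N₁ ≤ n := le_trans (le_max_right _ _) hn
    have hp := h0 (n + 1) (by omega)
    have hst := hstep n hnN
    have hu : κ * h (n + 1) ^ q ≤ 1 := by
      have := (hN₁ (n + 1) (by omega)).1
      rwa [le_div_iff₀ hκ, mul_comm] at this
    have hfac : h (n + 1) * (1 + κ * h (n + 1) ^ q) ≤ h n := by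
      rw [Real.rpow_add' hp (by positivity), Real.rpow_one] at hst
      linarith
    have hpq : 0 ≤ h (n + 1) ^ q := Real.rpow_nonneg hp q
    calc h (n + 1) ^ q * (1 + c * h (n + 1) ^ q)
        = h (n + 1) ^ q * (1 + q / 2 * (κ * h (n + 1) ^ q)) := by rw [hcdef]; ring
      _ ≤ h (n + 1) ^ q * (1 + κ * h (n + 1) ^ q) ^ q := by
          gcongr
          exact one_add_mul_le_rpow (by positivity) hu hq.le
      _ = (h (n + 1) * (1 + κ * h (n + 1) ^ q)) ^ q := by
          rw [Real.mul_rpow hp (by positivity)]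
      _ ≤ h n ^ q := by gcongr
  -- The constant 2 closes the induction: with `c r ≤ 1`, the error `c r (1 + c r)` is at most `2 c
  -- r`.
  have hbound : ∀ n, P ≤ n → h n ^ q * (c * ((n : ℝ) - P)) ≤ 2 := by
    intro n hn
    induction n, hn using Nat.le_induction with
    | base => simp
    | succ n hn ih =>
      have hn1 := hrec n hn
      have hb := (hN₁ (n + 1) (by have := le_max_right N N₁; omega)).2
      have hp : 0 ≤ h (n + 1) ^ q :=
        Real.rpow_nonneg (h0 (n + 1) (by have := le_max_left N N₁; omega)) q
      rw [le_div_iff₀ hc] at hb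
      have hk : 0 ≤ c * ((n : ℝ) - P) := by
        have : (P : ℝ) ≤ n := by exact_mod_cast hn
        exact mul_nonneg hc.le (by linarith)
      push_cast
      generalize h (n + 1) ^ q = r at *
      generalize h n ^ q = r' at *
      have h1 : r * (1 + c * r) * (c * ((n : ℝ) - P)) ≤ 2 :=
        (mul_le_mul_of_nonneg_right hn1 hk).trans ih
      set k := c * ((n : ℝ) - P) with hkdef
      have h2 : r * (c * ((n : ℝ) + 1 - P)) = r * k + c * r := by rw [hkdef]; ring
      rw [h2]
      by_contra! hcon
      have hcr : 0 ≤ c * r := by positivity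
      nlinarith [mul_lt_mul_of_pos_right hcon (show 0 < 1 + c * r by linarith)]
  refine ⟨(4 / c) ^ (1 / q), by positivity, 2 * P + 1, fun n hn => ?_⟩
  have hnP : P ≤ n := by omega
  have hh := h0 n (le_trans (le_max_left _ _) hnP)
  have hb := hbound n hnP
  have hn0 : (0 : ℝ) < n := by exact_mod_cast (by omega : 0 < n)
  have hhalf : (n : ℝ) / 2 ≤ n - P := by
    have : (2 * P + 1 : ℝ) ≤ n := by exact_mod_cast hn
    linarith
  have hle : h n ^ q ≤ 4 / c * (n : ℝ)⁻¹ := by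
    have hpq : 0 ≤ h n ^ q := Real.rpow_nonneg hh q
    have : h n ^ q * (c * (n / 2)) ≤ 2 := le_trans (by gcongr) hb
    rw [← div_eq_mul_inv, div_div, le_div_iff₀ (by positivity)]
    linarith
  calc h n = (h n ^ q) ^ (1 / q) := by
        rw [← Real.rpow_mul hh, mul_one_div_cancel hq.ne', Real.rpow_one]
    _ ≤ (4 / c * (n : ℝ)⁻¹) ^ (1 / q) := by
        gcongr
    _ = (4 / c) ^ (1 / q) * (n : ℝ) ^ (-(1 / q)) := by
        rw [Real.mul_rpow (by positivity) (by positivity), Real.inv_rpow hn0.le,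
          Real.rpow_neg hn0.le]

/-- The tangent inequality for the concave power `t ^ (1 - θ)`, cleared of denominators so that `a =
0` is allowed; it is weighted AM-GM for `a ^ θ * b ^ (1 - θ)`. -/
theorem one_sub_mul_sub_le_rpow {a b θ : ℝ} (ha : 0 ≤ a) (hb : 0 ≤ b) (hθ0 : 0 < θ) (hθ1 : θ < 1) :
    (1 - θ) * (a - b) ≤ a ^ θ * (a ^ (1 - θ) - b ^ (1 - θ)) := by
  have h := Real.geom_mean_le_arith_mean2_weighted hθ0.le (by linarith : 0 ≤ 1 - θ) ha hb
    (by ring)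
  have h1 : a ^ θ * a ^ (1 - θ) = a := by
    rw [← Real.rpow_add' ha (by norm_num)]; norm_num
  rw [mul_sub (a ^ θ), h1]
  linarith

theorem two_mul_le_add_of_sq_le_mul {a b c : ℝ} (hb : 0 ≤ b) (hc : 0 ≤ c)
    (h : a ^ 2 ≤ b * c) : 2 * a ≤ b + c := by
  by_contra! hlt
  nlinarith [sq_nonneg (b - c)]

end RealSequences

/-! ### The abstract finite-length argument. -/

section AbstractDescent

variable {V : Type*} [NormedAddCommGroup V]

/-- Finite-length argument: under sufficient decrease of `h` along the increments of `x` and a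
Kurdyka-Łojasiewicz inequality near a cluster point `p`, the sequence `x` stays near `p`, and both
`h` and the distance to `p` are controlled by `h`. -/
theorem exists_rate_of_descent {x : ℕ → V} {h : ℕ → ℝ} {p : V} {D E ε θ : ℝ} {N : ℕ}
    (hD : 0 < D) (hE : 0 < E) (hε : 0 < ε) (hθ : θ ∈ Set.Ico (1 / 2 : ℝ) 1)
    (h0 : ∀ n, N ≤ n → 0 ≤ h n) (hlim : Tendsto h atTop (𝓝 0))
    (hdesc : ∀ n, N ≤ n →
      h (n + 1) + D * (‖x (n + 1) - x n‖ + ‖x (n + 2) - x (n + 1)‖) ^ 2 ≤ h n)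
    (hKL : ∀ n, N ≤ n → ‖x (n + 2) - p‖ ≤ ε →
      h (n + 1) ^ θ ≤ E * (‖x (n + 1) - x n‖ + ‖x (n + 2) - x (n + 1)‖))
    (hp : ∃ φ : ℕ → ℕ, StrictMono φ ∧ Tendsto (fun k => x (φ k)) atTop (𝓝 p)) :
    ∃ κ c : ℝ, 0 < κ ∧ 0 < c ∧ ∃ N' : ℕ, N ≤ N' ∧ ∀ n, N' ≤ n →
      h (n + 1) + κ * h (n + 1) ^ (2 * θ) ≤ h n ∧ ‖x (n + 2) - p‖ ≤ c * h n ^ (1 - θ) := by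
  obtain ⟨hθ0, hθ1⟩ := hθ
  have hθpos : 0 < θ := by linarith
  set e : ℕ → ℝ := fun n => ‖x (n + 1) - x n‖ + ‖x (n + 2) - x (n + 1)‖ with he
  have e0 : ∀ n, 0 ≤ e n := fun n => by positivity
  have hd2 : ∀ n, ‖x (n + 2) - x (n + 1)‖ ≤ e n := fun n => by
    simp only [he]; linarith [norm_nonneg (x (n + 1) - x n)]
  set M : ℝ := E / (D * (1 - θ)) with hM
  have h1θ : 0 < 1 - θ := by linarith
  have hMpos : 0 < M := by positivity
  have hmono : ∀ n, N ≤ n → h (n + 1) ≤ h n := fun n hn => by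
    have := hdesc n hn
    have : 0 ≤ D * e n ^ 2 := by positivity
    linarith
  -- `T` is a potential dominating the remaining path length: inside the KL ball each step lowers it
  -- by at least `e (n + 1)`.
  set T : ℕ → ℝ := fun n => e n + M * h (n + 1) ^ (1 - θ) with hT
  have T0 : ∀ n, N ≤ n → 0 ≤ T n := fun n hn => by
    have := Real.rpow_nonneg (h0 (n + 1) (by omega)) (1 - θ)
    have := e0 n
    positivity
  have hTstep : ∀ n, N ≤ n → ‖x (n + 2) - p‖ ≤ ε → T (n + 1) + e (n + 1) ≤ T n := by
    intro n hn hball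
    have hk : h (n + 1) ^ θ ≤ E * e n := hKL n hn hball
    have hd : h (n + 2) + D * e (n + 1) ^ 2 ≤ h (n + 1) := hdesc (n + 1) (by omega)
    have a0 := h0 (n + 1) (by omega)
    have b0 := h0 (n + 2) (by omega)
    have hba := hmono (n + 1) (by omega)
    have hψ : 0 ≤ h (n + 1) ^ (1 - θ) - h (n + 2) ^ (1 - θ) := by
      have : h (n + 2) ^ (1 - θ) ≤ h (n + 1) ^ (1 - θ) := Real.rpow_le_rpow b0 hba h1θ.le
      linarith
    have hc := one_sub_mul_sub_le_rpow a0 b0 hθpos hθ1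
    have h3 : (1 - θ) * (D * e (n + 1) ^ 2)
        ≤ E * e n * (h (n + 1) ^ (1 - θ) - h (n + 2) ^ (1 - θ)) := by
      calc (1 - θ) * (D * e (n + 1) ^ 2) ≤ (1 - θ) * (h (n + 1) - h (n + 2)) := by
            gcongr; linarith
        _ ≤ _ := hc.trans (by gcongr)
    have h4 : e (n + 1) ^ 2 ≤ e n * (M * (h (n + 1) ^ (1 - θ) - h (n + 2) ^ (1 - θ))) := by
      have : e n * (M * (h (n + 1) ^ (1 - θ) - h (n + 2) ^ (1 - θ)))
          = E * e n * (h (n + 1) ^ (1 - θ) - h (n + 2) ^ (1 - θ)) / (D * (1 - θ)) := by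
        rw [hM]; ring
      rw [this, le_div_iff₀ (by positivity)]
      linarith
    have h5 := two_mul_le_add_of_sq_le_mul (e0 n) (by positivity) h4
    simp only [hT]
    linarith
  -- Decrease alone gives `e n ≤ √(h n / D)`; since `1 - θ ≤ 1/2` and `h n ≤ 1`, the weaker power `1
  -- - θ` also bounds it.
  have hsqrt : ∀ n, N ≤ n → h n ≤ 1 → e n ≤ Real.sqrt (1 / D) * h n ^ (1 - θ) := by
    intro n hn hn1
    have a0 := h0 n hn
    have h1 : e n ^ 2 ≤ 1 / D * h n := by
      have := hdesc n hn
      have := h0 (n + 1) (by omega)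
      rw [one_div, ← div_eq_inv_mul, le_div_iff₀ hD]
      linarith
    have h2 : e n ≤ Real.sqrt (1 / D) * h n ^ (1 / 2 : ℝ) := by
      rw [← Real.sqrt_eq_rpow, ← Real.sqrt_mul (by positivity)]
      exact Real.le_sqrt_of_sq_le h1
    exact h2.trans (mul_le_mul_of_nonneg_left
      (Real.rpow_le_rpow_of_exponent_ge' a0 hn1 h1θ.le (by linarith)) (Real.sqrt_nonneg _))
  obtain ⟨N₁, hN₁⟩ := eventually_atTop.1 (hlim.eventually_le_const (zero_lt_one (α := ℝ)))
  obtain ⟨c, hcpos, hcdef⟩ : ∃ c : ℝ, 0 < c ∧ c = Real.sqrt (1 / D) + M := ⟨_, by positivity, rfl⟩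
  have hTle : ∀ n, max N N₁ ≤ n → T n ≤ c * h n ^ (1 - θ) := by
    intro n hn
    have hn' : N ≤ n := le_trans (le_max_left _ _) hn
    have h1 := hsqrt n hn' (hN₁ n (le_trans (le_max_right _ _) hn))
    have h2 : h (n + 1) ^ (1 - θ) ≤ h n ^ (1 - θ) :=
      Real.rpow_le_rpow (h0 _ (by omega)) (hmono n hn') h1θ.le
    have h3 := mul_le_mul_of_nonneg_left h2 hMpos.le
    simp only [hT, hcdef]
    linarith
  have hTlim : Tendsto (fun n => c * h n ^ (1 - θ)) atTop (𝓝 0) := by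
    have := (hlim.rpow_const (p := 1 - θ) (Or.inr h1θ.le)).const_mul c
    rwa [Real.zero_rpow h1θ.ne', mul_zero] at this
  obtain ⟨φ, hφ, hφlim⟩ := hp
  obtain ⟨N₂, hN₂⟩ := eventually_atTop.1 (hTlim.eventually_le_const (half_pos hε))
  obtain ⟨k, hk, hkball⟩ : ∃ k, max (max N N₁) N₂ + 2 ≤ k ∧ ‖x (φ k) - p‖ ≤ ε / 2 := by
    have h1 : Tendsto (fun k => ‖x (φ k) - p‖) atTop (𝓝 0) :=
      tendsto_iff_norm_sub_tendsto_zero.1 hφlim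
    obtain ⟨k, hk1, hk2⟩ := ((h1.eventually_le_const (half_pos hε)).and
      (eventually_ge_atTop (max (max N N₁) N₂ + 2))).exists
    exact ⟨k, hk2, hk1⟩
  obtain ⟨P, hP⟩ : ∃ P, φ k = P + 2 := ⟨φ k - 2, by have := hφ.id_le k; simp at this; omega⟩
  have hPge : max (max N N₁) N₂ ≤ P := by have := hφ.id_le k; simp at this; omega
  have hPN : max N N₁ ≤ P := le_trans (le_max_left _ _) hPge
  have hPN' : N ≤ P := le_trans (le_max_left _ _) hPN
  -- KL needs the iterate in the ball, and staying in the ball needs KL. Carrying `T n` in the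
  -- invariant breaks the circle: the next displacement is paid for by the drop of `T`.
  have htrap : ∀ n, P ≤ n → ‖x (n + 2) - p‖ + T n ≤ ε := by
    intro n hn
    induction n, hn using Nat.le_induction with
    | base =>
      have h1 := (hTle P hPN).trans (hN₂ P (le_trans (le_max_right _ _) hPge))
      rw [hP] at hkball
      linarith
    | succ n hn ih =>
      have h1 := hTstep n (by omega) (by have := T0 n (by omega); linarith)
      have h2 := hd2 (n + 1)
      have h3 := norm_sub_le_norm_sub_add_norm_sub (x (n + 3)) (x (n + 2)) p
      show ‖x (n + 3) - p‖ + T (n + 1) ≤ ε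
      have h2' : ‖x (n + 3) - x (n + 2)‖ ≤ e (n + 1) := h2
      linarith
  have hball : ∀ n, P ≤ n → ‖x (n + 2) - p‖ ≤ ε := fun n hn => by
    have := T0 n (by omega); have := htrap n hn; linarith
  have htail : ∀ n, P ≤ n → ∀ j, n ≤ j → ‖x (n + 2) - x (j + 2)‖ + T j ≤ T n := by
    intro n hn j hj
    induction j, hj using Nat.le_induction with
    | base => simp
    | succ j hj ih =>
      have h1 := hTstep j (by omega) (hball j (by omega))
      have h2 : ‖x (j + 3) - x (j + 2)‖ ≤ e (j + 1) := hd2 (j + 1)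
      have h3 := norm_sub_le_norm_sub_add_norm_sub (x (n + 2)) (x (j + 2)) (x (j + 3))
      rw [norm_sub_rev (x (j + 2))] at h3
      show ‖x (n + 2) - x (j + 3)‖ + T (j + 1) ≤ T n
      linarith
  refine ⟨D / E ^ 2, c, by positivity, hcpos, P, hPN', fun n hn => ⟨?_, ?_⟩⟩
  · have h1 : h (n + 1) ^ θ ≤ E * e n := hKL n (by omega) (hball n hn)
    have h2 : h (n + 1) + D * e n ^ 2 ≤ h n := hdesc n (by omega)
    have a0 := h0 (n + 1) (by omega)
    have h3 : h (n + 1) ^ (2 * θ) ≤ E ^ 2 * e n ^ 2 := by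
      rw [mul_comm, Real.rpow_mul a0, Real.rpow_two, ← mul_pow]
      have := Real.rpow_nonneg a0 θ
      gcongr
    have h4 : D / E ^ 2 * h (n + 1) ^ (2 * θ) ≤ D * e n ^ 2 := by
      calc D / E ^ 2 * h (n + 1) ^ (2 * θ) ≤ D / E ^ 2 * (E ^ 2 * e n ^ 2) := by gcongr
        _ = D * e n ^ 2 := by field_simp
    linarith
  -- The tail bound is uniform in the later index, so it passes to the limit along the subsequence
  -- tending to `p`.
  · refine le_trans ?_ (hTle n (by omega))
    have hl : Tendsto (fun i => ‖x (n + 2) - x (φ i)‖) atTop (𝓝 ‖x (n + 2) - p‖) :=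
      (tendsto_const_nhds.sub hφlim).norm
    refine le_of_tendsto hl ?_
    filter_upwards [eventually_ge_atTop (n + 2)] with i hi
    have hφi : i ≤ φ i := by simpa using hφ.id_le i
    obtain ⟨j, hj⟩ : ∃ j, φ i = j + 2 := ⟨φ i - 2, by omega⟩
    have := htail n hn j (by omega)
    have := T0 j (by omega)
    rw [hj]
    linarith

end AbstractDescent

/-! ### Two-sided quadratic bounds for the smooth part. -/

section Smooth

variable {V : Type*} [NormedAddCommGroup V] [InnerProductSpace ℝ V] [CompleteSpace V]

/-- The descent lemma. -/
theorem le_quadratic_of_lipschitz_gradient {g : V → ℝ} {L : ℝ≥0} (hg : Differentiable ℝ g)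
    (hL : LipschitzWith L (gradient g)) (u v : V) :
    g v ≤ g u + inner ℝ (gradient g u) (v - u) + L / 2 * ‖v - u‖ ^ 2 := by
  set w := v - u with hw
  have hder : ∀ t : ℝ, HasDerivAt
      (fun t : ℝ => g (u + t • w) - t * inner ℝ (gradient g u) w - L / 2 * ‖w‖ ^ 2 * t ^ 2)
      (inner ℝ (gradient g (u + t • w)) w - inner ℝ (gradient g u) w
        - L / 2 * ‖w‖ ^ 2 * (2 * t)) t := by
    intro t
    have h1 : HasDerivAt (fun t : ℝ => u + t • w) w t := by
      simpa using ((hasDerivAt_id t).smul_const w).const_add u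
    have h2 : HasDerivAt (fun t : ℝ => g (u + t • w)) (inner ℝ (gradient g (u + t • w)) w) t := by
      have := ((hg (u + t • w)).hasGradientAt.hasFDerivAt).comp_hasDerivAt t h1
      rw [InnerProductSpace.toDual_apply_apply] at this
      exact this
    have h3 : HasDerivAt (fun t : ℝ => t * inner ℝ (gradient g u) w)
        (inner ℝ (gradient g u) w) t := by
      simpa using (hasDerivAt_id t).mul_const (inner ℝ (gradient g u) w)
    have h4 : HasDerivAt (fun t : ℝ => L / 2 * ‖w‖ ^ 2 * t ^ 2) (L / 2 * ‖w‖ ^ 2 * (2 * t)) t := by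
      simpa using (hasDerivAt_pow 2 t).const_mul (L / 2 * ‖w‖ ^ 2)
    exact (h2.sub h3).sub h4
  -- Along the segment, `g` minus its claimed quadratic majorant has nonpositive derivative, by
  -- Cauchy–Schwarz and the Lipschitz bound.
  have hanti := antitoneOn_of_deriv_nonpos (convex_Icc (0 : ℝ) 1)
    (fun t _ => (hder t).continuousAt.continuousWithinAt)
    (fun t _ => (hder t).differentiableAt.differentiableWithinAt) (by
      intro t ht
      rw [interior_Icc] at ht
      rw [(hder t).deriv, ← inner_sub_left]
      have h1 : ‖gradient g (u + t • w) - gradient g u‖ ≤ L * (t * ‖w‖) := by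
        have := hL.norm_sub_le (u + t • w) u
        rwa [add_sub_cancel_left, norm_smul, Real.norm_of_nonneg ht.1.le] at this
      have h2 := real_inner_le_norm (gradient g (u + t • w) - gradient g u) w
      have h3 := mul_le_mul_of_nonneg_right h1 (norm_nonneg w)
      nlinarith)
  have := hanti (Set.left_mem_Icc.2 zero_le_one) (Set.right_mem_Icc.2 zero_le_one) zero_le_one
  simp only [one_smul, zero_smul, add_zero] at this
  have hv : u + w = v := by rw [hw]; abel
  rw [hv] at this
  linarith

/-- The descent lemma for `-g`; it provides the quadratic minorant of `g` used to exhibit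
subgradients of `f + g`. -/
theorem quadratic_le_of_lipschitz_gradient {g : V → ℝ} {L : ℝ≥0} (hg : Differentiable ℝ g)
    (hL : LipschitzWith L (gradient g)) (u v : V) :
    g u + inner ℝ (gradient g u) (v - u) - L / 2 * ‖v - u‖ ^ 2 ≤ g v := by
  have hgrad : gradient (fun x => -g x) = fun x => -gradient g x := by
    funext x
    have h : HasGradientAt (fun x => -g x) (-gradient g x) x := by
      rw [hasGradientAt_iff_hasFDerivAt, map_neg]
      exact (hg x).hasGradientAt.hasFDerivAt.neg
    exact h.gradient
  have hL' : LipschitzWith L (gradient (fun x => -g x)) := by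
    rw [hgrad]
    exact hL.neg
  have h := le_quadratic_of_lipschitz_gradient (g := fun x => -g x) hg.neg hL' u v
  rw [hgrad] at h
  simp only [inner_neg_left] at h
  linarith

end Smooth

/-! ### Subgradients and the KL inequality in real form. -/

section Subdifferential

variable {V : Type*} [NormedAddCommGroup V] [InnerProductSpace ℝ V]

theorem frechetSubdiff_subset_limitingSubdiff (F : V → EReal) (x : V) :
    frechetSubdiff F x ⊆ limitingSubdiff F x := fun v hv =>
  ⟨hv.1, fun _ => x, fun _ => v, tendsto_const_nhds, tendsto_const_nhds, fun _ => hv,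
    tendsto_const_nhds⟩

/-- A vector defining a quadratic minorant that is exact at `p` is a Fréchet subgradient. -/
theorem mem_frechetSubdiff_of_quadratic_le {F : V → EReal} {p w : V} {r C : ℝ} (hp : F p = r)
    (hF : ∀ v, ((r + inner ℝ w (v - p) - C * ‖v - p‖ ^ 2 : ℝ) : EReal) ≤ F v) :
    w ∈ frechetSubdiff F p := by
  refine ⟨by rw [hp]; exact EReal.coe_lt_top r, ?_⟩
  refine le_of_forall_lt fun c hc => ?_
  obtain ⟨δ, hcδ, hδ⟩ := EReal.lt_iff_exists_real_btwn.1 hc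
  refine hcδ.trans_le (le_liminf_of_le (by isBoundedDefault) ?_)
  have hδ' : δ < 0 := by exact_mod_cast hδ
  have hlim : Tendsto (fun v => -C * ‖v - p‖) (𝓝[≠] p) (𝓝 0) := by
    have hcont : Continuous fun v : V => -C * ‖v - p‖ := by fun_prop
    have := hcont.tendsto p
    simp only [sub_self, norm_zero, mul_zero] at this
    exact this.mono_left nhdsWithin_le_nhds
  filter_upwards [hlim.eventually_const_le hδ', self_mem_nhdsWithin] with v hv hvp
  have hpos : 0 < ‖v - p‖ := norm_pos_iff.2 (sub_ne_zero.2 hvp)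
  rw [EReal.le_div_iff_mul_le (by exact_mod_cast hpos) (EReal.coe_ne_top _), hp]
  have hFv := hF v
  have hreal : δ * ‖v - p‖ ≤ -C * ‖v - p‖ ^ 2 := by nlinarith
  induction h : F v with
  | bot => rw [h] at hFv; exact absurd (le_bot_iff.1 hFv) (EReal.coe_ne_bot _)
  | top => simp
  | coe t =>
    rw [h] at hFv
    have hFv' : r + inner ℝ w (v - p) - C * ‖v - p‖ ^ 2 ≤ t := by exact_mod_cast hFv
    have : δ * ‖v - p‖ ≤ t - r - inner ℝ w (v - p) := by linarith
    exact_mod_cast this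

/-- The Kurdyka-Łojasiewicz inequality in terms of real numbers and Fréchet subgradients. -/
theorem HasKLExponentAt.exists_real {F : V → EReal} {p : V} {θ r : ℝ} (h : HasKLExponentAt F p θ)
    (hp : F p = r) :
    ∃ K ε η : ℝ, 0 < K ∧ 0 < ε ∧ 0 < η ∧ ∀ (u w : V) (t : ℝ), F u = t → ‖u - p‖ ≤ ε → r < t →
      t < r + η → w ∈ frechetSubdiff F u → (t - r) ^ θ ≤ K * ‖w‖ := by
  obtain ⟨-, K, ε, η, hK, hε, hη, hKL⟩ := h
  obtain ⟨η', hη', hη'η⟩ := EReal.lt_iff_exists_real_btwn.1 hη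
  -- A possibly infinite `η` is replaced by a smaller positive real.
  refine ⟨K, ε, η', hK, hε, by exact_mod_cast hη', fun u w t hu hball hrt htη hw => ?_⟩
  have h1 := hKL u hball (by rw [hp, hu]; exact_mod_cast hrt) (by
    rw [hp, hu]
    calc (t : EReal) < ((r + η' : ℝ) : EReal) := by exact_mod_cast htη
      _ = (r : EReal) + (η' : EReal) := EReal.coe_add _ _
      _ ≤ (r : EReal) + η := by gcongr)
  rw [hp, hu, EReal.toReal_coe, EReal.toReal_coe] at h1
  have h2 := h1.trans (Metric.infEDist_le_edist_of_mem
    (frechetSubdiff_subset_limitingSubdiff F u hw))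
  rw [edist_dist, dist_zero_left, ENNReal.ofReal_le_ofReal_iff (norm_nonneg _)] at h2
  rw [one_div, ← div_eq_inv_mul, div_le_iff₀ hK] at h2
  linarith

end Subdifferential

/-! ### The common proximal step and its one-step estimates. -/

section Scheme

variable {m : ℕ}

local notation "E" => EuclideanSpace ℝ (Fin m)

/-- The common form of the two schemes, as inequalities between real numbers: `x (n + 1)` minimizes
the proximal model at step `n`, with quadratic growth of modulus `(k - 1) / (2 s)`. -/
structure IsProximalStep (f : E → EReal) (g : E → ℝ) (s k : ℝ) (x y z : ℕ → E) : Prop where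
  ne_top : ∀ n, f (x (n + 1)) ≠ ⊤
  le : ∀ n v, f v ≠ ⊤ →
    (f (x (n + 1))).toReal + inner ℝ (gradient g (z n)) (x (n + 1) - y n)
        + 1 / (2 * s) * ‖x (n + 1) - y n‖ ^ 2 + (k - 1) / (2 * s) * ‖v - x (n + 1)‖ ^ 2
      ≤ (f v).toReal + inner ℝ (gradient g (z n)) (v - y n) + 1 / (2 * s) * ‖v - y n‖ ^ 2

theorem ne_top_of_forall_add_le {f : E → EReal} (hproper : ∃ u, f u < ⊤) {q : E → ℝ} {p : E}
    (h : ∀ v, f p + (q p : EReal) ≤ f v + (q v : EReal)) : f p ≠ ⊤ := by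
  obtain ⟨u, hu⟩ := hproper
  intro htop
  have h1 := h u
  rw [htop, EReal.top_add_coe] at h1
  exact (EReal.add_lt_top hu.ne (EReal.coe_ne_top _)).not_ge h1

theorem toReal_add_le_of_add_le {f : E → EReal} (hbot : ∀ u, f u ≠ ⊥) {q : E → ℝ} {p v : E}
    (hp : f p ≠ ⊤) (hv : f v ≠ ⊤) (h : f p + (q p : EReal) ≤ f v + (q v : EReal)) :
    (f p).toReal + q p ≤ (f v).toReal + q v := by
  rw [← EReal.coe_toReal hp (hbot p), ← EReal.coe_toReal hv (hbot v)] at h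
  exact_mod_cast h

theorem IsConvex.toReal_le {f : E → EReal} (hf : IsConvex f) (hbot : ∀ u, f u ≠ ⊥) {u v : E}
    (hu : f u ≠ ⊤) (hv : f v ≠ ⊤) {a b : ℝ} (ha : 0 < a) (hb : 0 < b) (hab : a + b = 1) :
    f (a • u + b • v) ≠ ⊤ ∧
      (f (a • u + b • v)).toReal ≤ a * (f u).toReal + b * (f v).toReal := by
  have h := hf u v a b ha hb hab
  rw [← EReal.coe_toReal hu (hbot u), ← EReal.coe_toReal hv (hbot v), ← EReal.coe_mul,
    ← EReal.coe_mul, ← EReal.coe_add] at h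
  have htop : f (a • u + b • v) ≠ ⊤ := ne_top_of_le_ne_top (EReal.coe_ne_top _) h
  refine ⟨htop, ?_⟩
  rw [← EReal.coe_toReal htop (hbot _)] at h
  exact_mod_cast h

theorem norm_sq_convex_comb_sub {p v u : E} {a b : ℝ} (hab : a + b = 1) :
    ‖a • p + b • v - u‖ ^ 2 = a * ‖p - u‖ ^ 2 + b * ‖v - u‖ ^ 2 - a * b * ‖v - p‖ ^ 2 := by
  have h1 : a • p + b • v - u = a • (p - u) + b • (v - u) := by
    have : u = (a + b) • u := by rw [hab, one_smul]
    rw [smul_sub, smul_sub]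
    nth_rewrite 1 [this]
    rw [add_smul]; abel
  have h2 : v - p = (v - u) - (p - u) := by abel
  rw [h1, h2, norm_add_sq_real, norm_sub_sq_real (v - u) (p - u), norm_smul, norm_smul, real_inner_smul_left,
    real_inner_smul_right, mul_pow, mul_pow, Real.norm_eq_abs, Real.norm_eq_abs, sq_abs, sq_abs,
    real_inner_comm (v - u)]
  obtain rfl : a = 1 - b := by linarith
  ring

/-- Quadratic growth at a proximal point of a convex function. -/
theorem IsProx.toReal_add_le {f : E → EReal} (hf : IsConvex f) (hbot : ∀ u, f u ≠ ⊥) {s : ℝ}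
    {u p v : E} (h : IsProx s f u p) (hp : f p ≠ ⊤) (hv : f v ≠ ⊤) :
    (f p).toReal + 1 / (2 * s) * ‖p - u‖ ^ 2 + 1 / (2 * s) * ‖v - p‖ ^ 2
      ≤ (f v).toReal + 1 / (2 * s) * ‖v - u‖ ^ 2 := by
  -- Minimality of `p` is tested at `(1 - t) p + t v` and divided by `t`; letting `t → 0` recovers
  -- the full growth term.
  have key : ∀ t ∈ Set.Ioo (0 : ℝ) 1,
      (f p).toReal + 1 / (2 * s) * ‖p - u‖ ^ 2 + (1 - t) * (1 / (2 * s) * ‖v - p‖ ^ 2)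
        ≤ (f v).toReal + 1 / (2 * s) * ‖v - u‖ ^ 2 := by
    rintro t ⟨ht0, ht1⟩
    obtain ⟨h1, h2⟩ := hf.toReal_le hbot hp hv (by linarith : 0 < 1 - t) ht0 (by ring)
    have h3 := toReal_add_le_of_add_le (q := fun v => 1 / (2 * s) * ‖v - u‖ ^ 2) hbot hp h1 (h _)
    rw [norm_sq_convex_comb_sub (by ring)] at h3
    have h4 : t * ((f p).toReal + 1 / (2 * s) * ‖p - u‖ ^ 2
        + (1 - t) * (1 / (2 * s) * ‖v - p‖ ^ 2))
        ≤ t * ((f v).toReal + 1 / (2 * s) * ‖v - u‖ ^ 2) := by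
      linarith
    exact le_of_mul_le_mul_left h4 ht0
  have hlim : Tendsto (fun t : ℝ => (f p).toReal + 1 / (2 * s) * ‖p - u‖ ^ 2
      + (1 - t) * (1 / (2 * s) * ‖v - p‖ ^ 2)) (𝓝[>] 0)
      (𝓝 ((f p).toReal + 1 / (2 * s) * ‖p - u‖ ^ 2 + 1 / (2 * s) * ‖v - p‖ ^ 2)) := by
    have hcont : Continuous fun t : ℝ => (f p).toReal + 1 / (2 * s) * ‖p - u‖ ^ 2
      + (1 - t) * (1 / (2 * s) * ‖v - p‖ ^ 2) := by fun_prop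
    have := hcont.tendsto 0
    simp only [sub_zero, one_mul] at this
    exact this.mono_left nhdsWithin_le_nhds
  refine le_of_tendsto hlim ?_
  filter_upwards [Ioo_mem_nhdsGT (zero_lt_one (α := ℝ))] with t ht using key t ht

theorem IsPADISNO.isProximalStep {f : E → EReal} {g : E → ℝ} {L : ℝ≥0} {α β : ℕ → ℝ} {s : ℝ}
    {x y z : ℕ → E} (hfg : IsProblem f g L) (h : IsPADISNO f g L α β s x y z) :
    IsProximalStep f g s 1 x y z := by
  have htop : ∀ n, f (x (n + 1)) ≠ ⊤ := fun n =>
    ne_top_of_forall_add_le hfg.proper (q := fun v => inner ℝ (gradient g (z n)) (v - y n)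
      + 1 / (2 * s) * ‖v - y n‖ ^ 2) (h.x_argmin n)
  refine ⟨htop, fun n v hv => ?_⟩
  have := toReal_add_le_of_add_le (q := fun v => inner ℝ (gradient g (z n)) (v - y n)
      + 1 / (2 * s) * ‖v - y n‖ ^ 2) hfg.ne_bot (htop n) hv (h.x_argmin n v)
  simp only [sub_self, zero_div, zero_mul]
  linarith

/-- Completing the square, the prox objective differs from the linearized model by a constant
independent of the test point; convexity then gives `k = 2`. -/
theorem IsConvexPADISNO.isProximalStep {f : E → EReal} {g : E → ℝ} {L : ℝ≥0} {α β : ℕ → ℝ} {s : ℝ}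
    {x y z : ℕ → E} (hfg : IsProblem f g L) (h : IsConvexPADISNO f g L α β s x y z) (hs : 0 < s) :
    IsProximalStep f g s 2 x y z := by
  have htop : ∀ n, f (x (n + 1)) ≠ ⊤ := fun n =>
    ne_top_of_forall_add_le hfg.proper
      (q := fun v => 1 / (2 * s) * ‖v - (y n - s • gradient g (z n))‖ ^ 2) (h.x_prox n)
  refine ⟨htop, fun n v hv => ?_⟩
  have h1 := (h.x_prox n).toReal_add_le h.convex hfg.ne_bot (htop n) hv
  have hexp : ∀ w : E, 1 / (2 * s) * ‖w - (y n - s • gradient g (z n))‖ ^ 2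
      = 1 / (2 * s) * ‖w - y n‖ ^ 2 + inner ℝ (gradient g (z n)) (w - y n)
        + s / 2 * ‖gradient g (z n)‖ ^ 2 := by
    intro w
    have : w - (y n - s • gradient g (z n)) = (w - y n) + s • gradient g (z n) := by abel
    rw [this, norm_add_sq_real, norm_smul, real_inner_smul_right, mul_pow, Real.norm_eq_abs, sq_abs,
      real_inner_comm]
    field_simp
  rw [hexp, hexp] at h1
  have h2 : ((2 : ℝ) - 1) / (2 * s) = 1 / (2 * s) := by norm_num
  rw [h2]
  linarith

/-- Instead of a sum rule, minimality gives a quadratic minorant of `f` exact at `x (n + 1)`, and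
the lower bound for `g` gives another; their sum has the stated slope. -/
theorem IsProximalStep.mem_frechetSubdiff {f : E → EReal} {g : E → ℝ} {L : ℝ≥0} {s k : ℝ}
    {x y z : ℕ → E} (hfg : IsProblem f g L) (hs : 0 < s) (hk : 1 ≤ k)
    (h : IsProximalStep f g s k x y z) (n : ℕ) :
    gradient g (x (n + 1)) - gradient g (z n) - s⁻¹ • (x (n + 1) - y n)
      ∈ frechetSubdiff (objective f g) (x (n + 1)) := by
  set p := x (n + 1) with hp
  have hobj : objective f g p = (((f p).toReal + g p : ℝ) : EReal) := by
    rw [objective, EReal.coe_add, EReal.coe_toReal (h.ne_top n) (hfg.ne_bot _)]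
  refine mem_frechetSubdiff_of_quadratic_le (C := L / 2 + 1 / (2 * s)) hobj fun v => ?_
  by_cases hv : f v = ⊤
  · simp [objective, hv]
  rw [objective, ← EReal.coe_toReal hv (hfg.ne_bot v), ← EReal.coe_add, EReal.coe_le_coe_iff]
  have h1 := h.le n v hv
  rw [← hp] at h1
  have h2 := quadratic_le_of_lipschitz_gradient hfg.differentiable hfg.lipschitz_gradient p v
  have h3 : 0 ≤ (k - 1) / (2 * s) * ‖v - p‖ ^ 2 := by
    have : 0 ≤ k - 1 := by linarith
    positivity
  have hd : v - y n = (v - p) + (p - y n) := by abel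
  rw [hd, norm_add_sq_real, inner_add_right] at h1
  rw [inner_sub_left, inner_sub_left, real_inner_smul_left, real_inner_comm (v - p) (p - y n)]
  have h4 : 1 / (2 * s) * (‖v - p‖ ^ 2 + 2 * inner ℝ (v - p) (p - y n) + ‖p - y n‖ ^ 2)
      = 1 / (2 * s) * ‖v - p‖ ^ 2 + s⁻¹ * inner ℝ (v - p) (p - y n)
        + 1 / (2 * s) * ‖p - y n‖ ^ 2 := by
    field_simp
  rw [h4] at h1
  linarith

theorem norm_inertialStep_sub_le (γ : ℕ → ℝ) (x : ℕ → E) (n : ℕ) :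
    ‖x (n + 2) - inertialStep γ x (n + 1)‖
      ≤ ‖x (n + 2) - x (n + 1)‖ + |γ (n + 1)| * ‖x (n + 1) - x n‖ := by
  have : x (n + 2) - inertialStep γ x (n + 1)
      = (x (n + 2) - x (n + 1)) - γ (n + 1) • (x (n + 1) - x n) := by
    simp only [inertialStep, Nat.add_sub_cancel]; abel
  rw [this, ← Real.norm_eq_abs, ← norm_smul]
  exact norm_sub_le _ _

/-- The one-step estimate for the objective function. -/
theorem IsProximalStep.step_le {f : E → EReal} {g : E → ℝ} {L : ℝ≥0} {s k : ℝ} {α β : ℕ → ℝ}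
    {x y z : ℕ → E} (hfg : IsProblem f g L) (hs : 0 < s)
    (h : IsProximalStep f g s k x y z) (hy : ∀ n, y n = inertialStep α x n)
    (hz : ∀ n, z n = inertialStep β x n) {c : ℝ} (n : ℕ)
    (hc : |α (n + 1)| / s + L * |β (n + 1)| ≤ c) :
    (f (x (n + 2))).toReal + g (x (n + 2))
        + (k / (2 * s) - L / 2 - c / 2) * ‖x (n + 2) - x (n + 1)‖ ^ 2
      ≤ (f (x (n + 1))).toReal + g (x (n + 1)) + c / 2 * ‖x (n + 1) - x n‖ ^ 2 := by
  -- The test point is the previous iterate. The terms `‖α v‖²` occur on both sides and cancel, so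
  -- `α` enters only through a cross term.
  have h1 := h.le (n + 1) (x (n + 1)) (h.ne_top n)
  have h2 := le_quadratic_of_lipschitz_gradient hfg.differentiable hfg.lipschitz_gradient
    (x (n + 1)) (x (n + 2))
  have hyn : y (n + 1) = x (n + 1) + α (n + 1) • (x (n + 1) - x n) := by
    rw [hy]; simp [inertialStep]
  have hzn : z (n + 1) = x (n + 1) + β (n + 1) • (x (n + 1) - x n) := by
    rw [hz]; simp [inertialStep]
  have h3 : ‖gradient g (x (n + 1)) - gradient g (z (n + 1))‖
      ≤ L * (|β (n + 1)| * ‖x (n + 1) - x n‖) := by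
    have := hfg.lipschitz_gradient.norm_sub_le (x (n + 1)) (z (n + 1))
    rwa [hzn, sub_add_cancel_left, norm_neg, norm_smul, Real.norm_eq_abs, ← hzn] at this
  set G := gradient g (z (n + 1)) with hG
  set G' := gradient g (x (n + 1)) with hG'
  set u := x (n + 2) - x (n + 1) with hu
  set v := x (n + 1) - x n with hv
  have e1 : x (n + 1 + 1) - y (n + 1) = u - α (n + 1) • v := by rw [hyn, hu]; abel
  have e2 : x (n + 1) - y (n + 1) = -(α (n + 1) • v) := by rw [hyn]; abel
  have e3 : x (n + 1) - x (n + 1 + 1) = -u := by rw [hu]; abel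
  rw [e1, e2, e3, norm_neg, norm_neg, inner_sub_right, inner_neg_right, norm_sub_sq_real,
    real_inner_smul_right u v] at h1
  have h4 : inner ℝ G' u - inner ℝ G u ≤ L * |β (n + 1)| * (‖v‖ * ‖u‖) := by
    rw [← inner_sub_left]
    calc inner ℝ (G' - G) u ≤ ‖G' - G‖ * ‖u‖ := real_inner_le_norm _ _
      _ ≤ L * (|β (n + 1)| * ‖v‖) * ‖u‖ := by gcongr
      _ = _ := by ring
  have h5 : α (n + 1) * inner ℝ u v ≤ |α (n + 1)| * (‖v‖ * ‖u‖) := by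
    calc α (n + 1) * inner ℝ u v ≤ |α (n + 1) * inner ℝ u v| := le_abs_self _
      _ = |α (n + 1)| * |inner ℝ u v| := abs_mul _ _
      _ ≤ |α (n + 1)| * (‖u‖ * ‖v‖) := by gcongr; exact abs_real_inner_le_norm _ _
      _ = _ := by ring
  have h6 : 1 / s * (α (n + 1) * inner ℝ u v) ≤ |α (n + 1)| / s * (‖v‖ * ‖u‖) := by
    calc 1 / s * (α (n + 1) * inner ℝ u v) ≤ 1 / s * (|α (n + 1)| * (‖v‖ * ‖u‖)) := by gcongr
      _ = _ := by ring
  have h7 : (|α (n + 1)| / s + L * |β (n + 1)|) * (‖v‖ * ‖u‖) ≤ c * (‖v‖ * ‖u‖) := by gcongr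
  have h8 : c * (‖v‖ * ‖u‖) ≤ c / 2 * ‖u‖ ^ 2 + c / 2 * ‖v‖ ^ 2 := by
    have hc0 : 0 ≤ c := le_trans (by positivity) hc
    nlinarith [mul_nonneg hc0 (sq_nonneg (‖u‖ - ‖v‖))]
  have h9 : 1 / (2 * s) * (‖u‖ ^ 2 - 2 * (α (n + 1) * inner ℝ u v) + ‖α (n + 1) • v‖ ^ 2)
        + (k - 1) / (2 * s) * ‖u‖ ^ 2
      = k / (2 * s) * ‖u‖ ^ 2 - 1 / s * (α (n + 1) * inner ℝ u v)
        + 1 / (2 * s) * ‖α (n + 1) • v‖ ^ 2 := by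
    field_simp; ring
  have h10 : (f (x (n + 1 + 1))).toReal = (f (x (n + 2))).toReal := rfl
  linarith

end Scheme

/-! ### Energy decrease and rates along the iterates. -/

section Convergence

variable {m : ℕ}

local notation "E" => EuclideanSpace ℝ (Fin m)

/-- The value of `f + g` as a real number, meaningful on the domain of `f`. -/
noncomputable def realObjective (f : E → EReal) (g : E → ℝ) (u : E) : ℝ := (f u).toReal + g u

theorem objective_eq_coe {f : E → EReal} {g : E → ℝ} {L : ℝ≥0} (hfg : IsProblem f g L) {u : E}
    (hu : f u ≠ ⊤) : objective f g u = (realObjective f g u : EReal) := by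
  rw [objective, realObjective, EReal.coe_add, EReal.coe_toReal hu (hfg.ne_bot _)]

theorem tendsto_of_eventually_antitone {H : ℕ → ℝ} {N : ℕ} {c : ℝ}
    (hH : ∀ n, N ≤ n → H (n + 1) ≤ H n) (hc : ∀ n, c ≤ H n) :
    ∃ l, Tendsto H atTop (𝓝 l) ∧ ∀ n, N ≤ n → l ≤ H n := by
  have hanti : Antitone fun n => H (n + N) := antitone_nat_of_succ_le fun n => by
    have := hH (n + N) (by omega)
    rwa [show n + 1 + N = n + N + 1 by omega]
  have hbdd : BddBelow (Set.range fun n => H (n + N)) := ⟨c, by rintro _ ⟨n, rfl⟩; exact hc _⟩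
  refine ⟨_, (tendsto_add_atTop_iff_nat N).1 (tendsto_atTop_ciInf hanti hbdd), fun n hn => ?_⟩
  have := ciInf_le hbdd (n - N)
  simpa [Nat.sub_add_cancel hn] using this

theorem tendsto_inertialStep_sub {γ : ℕ → ℝ} {c : ℝ} {x : ℕ → E} (hγ : Tendsto γ atTop (𝓝 c))
    (hd : Tendsto (fun n => ‖x (n + 1) - x n‖) atTop (𝓝 0)) :
    Tendsto (fun n => x (n + 1) - inertialStep γ x n) atTop (𝓝 0) := by
  rw [← tendsto_add_atTop_iff_nat 1, tendsto_zero_iff_norm_tendsto_zero]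
  have h1 : Tendsto (fun n => ‖x (n + 2) - x (n + 1)‖ + |γ (n + 1)| * ‖x (n + 1) - x n‖) atTop
      (𝓝 (0 + |c| * 0)) :=
    ((tendsto_add_atTop_iff_nat 1).2 hd).add
      (((tendsto_add_atTop_iff_nat 1).2 hγ).abs.mul hd)
  rw [mul_zero, add_zero] at h1
  exact squeeze_zero (fun _ => norm_nonneg _) (fun n => norm_inertialStep_sub_le γ x n) h1

/-- At a cluster point the objective function takes the limit of its values along the iterates. -/
theorem IsProximalStep.realObjective_eq {f : E → EReal} {g : E → ℝ} {L : ℝ≥0} {s k a b l : ℝ}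
    {α β : ℕ → ℝ} {x y z : ℕ → E} {xstar : E} (hfg : IsProblem f g L) (hs : 0 < s) (hk : 1 ≤ k)
    (h : IsProximalStep f g s k x y z) (hy : ∀ n, y n = inertialStep α x n)
    (hz : ∀ n, z n = inertialStep β x n) (hα : Tendsto α atTop (𝓝 a)) (hβ : Tendsto β atTop (𝓝 b))
    (hd : Tendsto (fun n => ‖x (n + 1) - x n‖) atTop (𝓝 0))
    (hl : Tendsto (fun n => realObjective f g (x (n + 1))) atTop (𝓝 l))
    (hx : IsSeqClusterPt x xstar) (htop : f xstar ≠ ⊤) : realObjective f g xstar = l := by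
  obtain ⟨φ, hφ, hφlim⟩ := hx
  obtain ⟨ψ, hψ, hψlim⟩ : ∃ ψ : ℕ → ℕ, Tendsto ψ atTop atTop ∧
      Tendsto (fun i => x (ψ i + 1)) atTop (𝓝 xstar) := by
    refine ⟨fun i => φ (i + 1) - 1, ?_, ?_⟩
    · refine tendsto_atTop_mono (fun i => ?_) tendsto_id
      have : i + 1 ≤ φ (i + 1) := by simpa using hφ.id_le (i + 1)
      simp only [id]; omega
    · have h1 := (tendsto_add_atTop_iff_nat 1).2 hφlim
      refine h1.congr fun i => ?_
      have : i + 1 ≤ φ (i + 1) := by simpa using hφ.id_le (i + 1)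
      rw [Nat.sub_add_cancel (by omega)]
  have hgcont : Continuous g := hfg.differentiable.continuous
  have hgradcont : Continuous (gradient g) := hfg.lipschitz_gradient.continuous
  have hg : Tendsto (fun i => g (x (ψ i + 1))) atTop (𝓝 (g xstar)) :=
    (hgcont.tendsto xstar).comp hψlim
  have hf : Tendsto (fun i => (f (x (ψ i + 1))).toReal) atTop (𝓝 (l - g xstar)) := by
    have := (hl.comp hψ).sub hg
    refine this.congr fun i => ?_
    simp [realObjective]
  have hγ : ∀ {γ : ℕ → ℝ} {c : ℝ}, Tendsto γ atTop (𝓝 c) →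
      Tendsto (fun i => inertialStep γ x (ψ i)) atTop (𝓝 xstar) := by
    intro γ c hc
    have := hψlim.sub ((tendsto_inertialStep_sub hc hd).comp hψ)
    rw [sub_zero] at this
    refine this.congr fun i => ?_
    simp
  have hyl : Tendsto (fun i => y (ψ i)) atTop (𝓝 xstar) := by simpa only [hy] using hγ hα
  have hzl : Tendsto (fun i => z (ψ i)) atTop (𝓝 xstar) := by simpa only [hz] using hγ hβ
  -- Lower semicontinuity gives only the opposite inequality; this one comes from testing the model
  -- at `xstar`.
  have hupper : l - g xstar ≤ (f xstar).toReal := by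
    have hrhs : Tendsto (fun i => (f xstar).toReal
        + inner ℝ (gradient g (z (ψ i))) (xstar - x (ψ i + 1))
        + 1 / (2 * s) * ‖xstar - y (ψ i)‖ ^ 2) atTop
        (𝓝 ((f xstar).toReal + inner ℝ (gradient g xstar) (xstar - xstar)
          + 1 / (2 * s) * ‖xstar - xstar‖ ^ 2)) :=
      (tendsto_const_nhds.add (((hgradcont.tendsto xstar).comp hzl).inner
        (tendsto_const_nhds.sub hψlim))).add
        (((tendsto_const_nhds.sub hyl).norm.pow 2).const_mul _)
    simp only [sub_self, inner_zero_right, norm_zero, add_zero, ne_eq, OfNat.ofNat_ne_zero,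
      not_false_eq_true, zero_pow, mul_zero] at hrhs
    refine le_of_tendsto_of_tendsto' hf hrhs fun i => ?_
    have h1 := h.le (ψ i) xstar htop
    have h2 : 0 ≤ 1 / (2 * s) * ‖x (ψ i + 1) - y (ψ i)‖ ^ 2 := by positivity
    have h3 : 0 ≤ (k - 1) / (2 * s) * ‖xstar - x (ψ i + 1)‖ ^ 2 := by
      have : 0 ≤ k - 1 := by linarith
      positivity
    have h4 : xstar - x (ψ i + 1) = (xstar - y (ψ i)) - (x (ψ i + 1) - y (ψ i)) := by abel
    rw [h4, inner_sub_right]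
    linarith
  have hlower : (f xstar).toReal ≤ l - g xstar := by
    refine le_of_forall_lt fun c hc => ?_
    obtain ⟨c', hcc', hc'⟩ := exists_between hc
    refine hcc'.trans_le (ge_of_tendsto hf ?_)
    have hlt : (c' : EReal) < f xstar := by
      rw [← EReal.coe_toReal htop (hfg.ne_bot _)]
      exact_mod_cast hc'
    filter_upwards [hψlim.eventually (hfg.lsc xstar c' hlt)] with i hi
    rw [← EReal.coe_toReal (h.ne_top (ψ i)) (hfg.ne_bot _)] at hi
    exact (EReal.coe_lt_coe_iff.1 hi).le
  rw [realObjective]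
  linarith

/-- Sufficient decrease of the energy `(f + g) (x (n + 1)) - (f + g) xstar + C ‖x (n + 1) - x n‖²`,
which vanishes in the limit. -/
theorem IsProximalStep.exists_energy {f : E → EReal} {g : E → ℝ} {L : ℝ≥0} {s k a b : ℝ}
    {α β : ℕ → ℝ} {x y z : ℕ → E} {xstar : E} (hfg : IsProblem f g L) (hs : 0 < s) (hk : 1 ≤ k)
    (h : IsProximalStep f g s k x y z) (hy : ∀ n, y n = inertialStep α x n)
    (hz : ∀ n, z n = inertialStep β x n) (hα : Tendsto α atTop (𝓝 a)) (hβ : Tendsto β atTop (𝓝 b))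
    (hstep : s * (L * (2 * |b| + 1)) + 2 * |a| < k) (hbdd : BoundedFromBelow (objective f g))
    (hx : IsSeqClusterPt x xstar) (htop : f xstar ≠ ⊤) :
    ∃ C D : ℝ, 0 < C ∧ 0 < D ∧ ∃ N : ℕ, ∃ e : ℕ → ℝ,
      (∀ n, e n = realObjective f g (x (n + 1)) - realObjective f g xstar
        + C * ‖x (n + 1) - x n‖ ^ 2) ∧
      (∀ n, N ≤ n → 0 ≤ e n) ∧ Tendsto e atTop (𝓝 0) ∧
      (∀ n, N ≤ n →
        e (n + 1) + D * (‖x (n + 1) - x n‖ + ‖x (n + 2) - x (n + 1)‖) ^ 2 ≤ e n) ∧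
      Tendsto (fun n => ‖x (n + 1) - x n‖) atTop (𝓝 0) ∧
      Tendsto (fun n => realObjective f g (x (n + 1))) atTop (𝓝 (realObjective f g xstar)) := by
  -- This is the step size condition rearranged. The gap leaves room for `c`, which eventually
  -- bounds the inertial coefficients.
  have hc₀ : |a| / s + L * |b| < (k / s - L) / 2 := by
    rw [lt_div_iff₀ two_pos, lt_sub_iff_add_lt, lt_div_iff₀ hs]
    calc ((|a| / s + L * |b|) * 2 + L) * s = s * (L * (2 * |b| + 1)) + 2 * |a| := by
          field_simp; ring
      _ < k := hstep
  obtain ⟨c, hc1, hc2⟩ := exists_between hc₀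
  have hc0 : 0 ≤ c := le_trans (by positivity) hc1.le
  have hclim : Tendsto (fun n => |α n| / s + L * |β n|) atTop (𝓝 (|a| / s + L * |b|)) :=
    (hα.abs.div_const s).add (hβ.abs.const_mul _)
  obtain ⟨N, hN⟩ := eventually_atTop.1 (hclim.eventually_le_const hc1)
  -- The coefficient of `d (n + 1) ^ 2` in the one-step estimate becomes `c / 2 + 2 * D`: the energy
  -- keeps `c / 2 + D`, and `D` remains as decrease. Adding `D * d n ^ 2` to both sides yields the
  -- decrease in `d n`.
  obtain ⟨D, hD, hDdef⟩ : ∃ D : ℝ, 0 < D ∧ 4 * D = k / s - L - 2 * c :=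
    ⟨(k / s - L - 2 * c) / 4, by linarith, by ring⟩
  set d : ℕ → ℝ := fun n => ‖x (n + 1) - x n‖ with hd
  set Fr : ℕ → ℝ := fun n => realObjective f g (x (n + 1)) with hFr
  have hstep' : ∀ n, N ≤ n → Fr (n + 1) + (c / 2 + D) * d (n + 1) ^ 2
      + D * (d n ^ 2 + d (n + 1) ^ 2) ≤ Fr n + (c / 2 + D) * d n ^ 2 := by
    intro n hn
    have h1 := h.step_le hfg hs hy hz n (hN (n + 1) (by omega))
    have h2 : k / (2 * s) - L / 2 - c / 2 = c / 2 + 2 * D := by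
      have : k / (2 * s) = k / s / 2 := by field_simp
      rw [this]; linarith
    rw [h2] at h1
    simp only [hFr, hd, realObjective]
    have e1 : n + 1 + 1 = n + 2 := rfl
    rw [e1]
    linarith
  obtain ⟨B, hB⟩ := hbdd
  have hFrB : ∀ n, B ≤ Fr n := by
    intro n
    have := hB (x (n + 1))
    rw [objective_eq_coe hfg (h.ne_top n)] at this
    exact_mod_cast this
  obtain ⟨l, hl, hlle⟩ := tendsto_of_eventually_antitone (N := N) (c := B)
    (H := fun n => Fr n + (c / 2 + D) * d n ^ 2)
    (fun n hn => by
      have := hstep' n hn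
      have : 0 ≤ D * (d n ^ 2 + d (n + 1) ^ 2) := by positivity
      linarith)
    (fun n => by
      have := hFrB n
      have : 0 ≤ (c / 2 + D) * d n ^ 2 := by positivity
      linarith)
  have hdsq : Tendsto (fun n => d n ^ 2) atTop (𝓝 0) := by
    have hdiff : Tendsto (fun n => D⁻¹ * ((Fr n + (c / 2 + D) * d n ^ 2)
        - (Fr (n + 1) + (c / 2 + D) * d (n + 1) ^ 2))) atTop (𝓝 (D⁻¹ * (l - l))) :=
      (hl.sub ((tendsto_add_atTop_iff_nat 1).2 hl)).const_mul _
    rw [sub_self, mul_zero] at hdiff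
    refine squeeze_zero' (Eventually.of_forall fun n => sq_nonneg _) ?_ hdiff
    filter_upwards [eventually_ge_atTop N] with n hn
    have h1 := hstep' n hn
    have h2 : 0 ≤ D * d (n + 1) ^ 2 := by positivity
    rw [← div_eq_inv_mul, le_div_iff₀ hD]
    linarith
  have hdlim : Tendsto d atTop (𝓝 0) := by
    have := hdsq.sqrt
    rw [Real.sqrt_zero] at this
    exact this.congr fun n => Real.sqrt_sq (norm_nonneg _)
  have hFrlim : Tendsto Fr atTop (𝓝 l) := by
    have := hl.sub (hdsq.const_mul (c / 2 + D))
    rw [mul_zero, sub_zero] at this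
    exact this.congr fun n => by ring
  have hstar := h.realObjective_eq hfg hs hk hy hz hα hβ hdlim hFrlim hx htop
  rw [← hstar] at hl hlle hFrlim
  refine ⟨c / 2 + D, D / 2, by positivity, by positivity, N, _, fun n => rfl, ?_, ?_, ?_, hdlim,
    hFrlim⟩
  · intro n hn
    have := hlle n hn
    simp only [hFr, hd] at this ⊢
    linarith
  · have := hl.sub_const (realObjective f g xstar)
    rw [sub_self] at this
    exact this.congr fun n => by simp only [hFr, hd]; ring
  · intro n hn
    have h1 := hstep' n hn
    have h2 : D / 2 * (d n + d (n + 1)) ^ 2 ≤ D * (d n ^ 2 + d (n + 1) ^ 2) := by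
      nlinarith [mul_nonneg hD.le (sq_nonneg (d n - d (n + 1)))]
    simp only [hFr, hd] at h1 h2 ⊢
    have e1 : n + 1 + 1 = n + 2 := rfl
    rw [e1] at *
    linarith

theorem norm_subgradient_le {f : E → EReal} {g : E → ℝ} {L : ℝ≥0} {s A : ℝ} {α β : ℕ → ℝ}
    {x y z : ℕ → E} (hfg : IsProblem f g L) (hs : 0 < s) (hy : ∀ n, y n = inertialStep α x n)
    (hz : ∀ n, z n = inertialStep β x n) (hα : ∀ n, |α n| ≤ A) (hβ : ∀ n, |β n| ≤ A) (n : ℕ) :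
    ‖gradient g (x (n + 2)) - gradient g (z (n + 1)) - s⁻¹ • (x (n + 2) - y (n + 1))‖
      ≤ (L + s⁻¹) * (1 + A) * (‖x (n + 1) - x n‖ + ‖x (n + 2) - x (n + 1)‖) := by
  have hA : 0 ≤ A := (abs_nonneg _).trans (hα 0)
  have key : ∀ γ : ℕ → ℝ, (∀ n, |γ n| ≤ A) → ‖x (n + 2) - inertialStep γ x (n + 1)‖
      ≤ (1 + A) * (‖x (n + 1) - x n‖ + ‖x (n + 2) - x (n + 1)‖) := by
    intro γ hγ
    have h1 := norm_inertialStep_sub_le γ x n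
    have h2 := mul_le_mul_of_nonneg_right (hγ (n + 1)) (norm_nonneg (x (n + 1) - x n))
    nlinarith [norm_nonneg (x (n + 1) - x n), mul_nonneg hA (norm_nonneg (x (n + 2) - x (n + 1)))]
  have hzk := key β hβ
  have hyk := key α hα
  rw [← hz] at hzk
  rw [← hy] at hyk
  calc ‖gradient g (x (n + 2)) - gradient g (z (n + 1)) - s⁻¹ • (x (n + 2) - y (n + 1))‖
      ≤ ‖gradient g (x (n + 2)) - gradient g (z (n + 1))‖ + ‖s⁻¹ • (x (n + 2) - y (n + 1))‖ :=
        norm_sub_le _ _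
    _ ≤ L * ‖x (n + 2) - z (n + 1)‖ + s⁻¹ * ‖x (n + 2) - y (n + 1)‖ := by
        rw [norm_smul, Real.norm_of_nonneg (inv_nonneg.2 hs.le)]
        gcongr
        exact hfg.lipschitz_gradient.norm_sub_le _ _
    _ ≤ L * ((1 + A) * (‖x (n + 1) - x n‖ + ‖x (n + 2) - x (n + 1)‖))
        + s⁻¹ * ((1 + A) * (‖x (n + 1) - x n‖ + ‖x (n + 2) - x (n + 1)‖)) := by gcongr
    _ = _ := by ring

theorem norm_inertialStep_sub_le_of_le {γ : ℕ → ℝ} {x : ℕ → E} {p : E} {A r : ℝ} {n : ℕ}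
    (hγ : |γ (n + 1)| ≤ A) (h0 : ‖x n - p‖ ≤ r) (h1 : ‖x (n + 1) - p‖ ≤ r) :
    ‖inertialStep γ x (n + 1) - p‖ ≤ (1 + 2 * A) * r := by
  have e : inertialStep γ x (n + 1) - p
      = (x (n + 1) - p) + γ (n + 1) • ((x (n + 1) - p) - (x n - p)) := by
    simp only [inertialStep, Nat.add_sub_cancel]
    rw [sub_sub_sub_cancel_right]; abel
  have hA : 0 ≤ A := (abs_nonneg _).trans hγ
  calc ‖inertialStep γ x (n + 1) - p‖
      ≤ ‖x (n + 1) - p‖ + |γ (n + 1)| * ‖(x (n + 1) - p) - (x n - p)‖ := by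
        rw [e, ← Real.norm_eq_abs, ← norm_smul]; exact norm_add_le _ _
    _ ≤ r + A * (r + r) := by
        gcongr
        exact (norm_sub_le _ _).trans (by gcongr)
    _ = (1 + 2 * A) * r := by ring

/-- Rates of convergence in terms of a vanishing energy `e`. -/
theorem IsProximalStep.exists_rate {f : E → EReal} {g : E → ℝ} {L : ℝ≥0} {s k a b θ : ℝ}
    {α β : ℕ → ℝ} {x y z : ℕ → E} {xstar : E} (hfg : IsProblem f g L) (hs : 0 < s) (hk : 1 ≤ k)
    (h : IsProximalStep f g s k x y z) (hy : ∀ n, y n = inertialStep α x n)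
    (hz : ∀ n, z n = inertialStep β x n) (hα : Tendsto α atTop (𝓝 a)) (hβ : Tendsto β atTop (𝓝 b))
    (hstep : s * (L * (2 * |b| + 1)) + 2 * |a| < k) (hbdd : BoundedFromBelow (objective f g))
    (hx : IsSeqClusterPt x xstar) (hθ : θ ∈ Set.Ico (1 / 2 : ℝ) 1)
    (hKL : HasKLExponentAt (objective f g) xstar θ) :
    ∃ κ c : ℝ, 0 < κ ∧ 0 < c ∧ ∃ e : ℕ → ℝ, ∃ N : ℕ, Tendsto e atTop (𝓝 0) ∧
      (∀ n, N ≤ n → 0 ≤ e n) ∧ (∀ n, N ≤ n → e (n + 1) + κ * e (n + 1) ^ (2 * θ) ≤ e n) ∧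
      ∀ n, N ≤ n →
        objective f g (x (n + 3)) - objective f g xstar ≤ (e n : EReal) ∧
        ‖x (n + 3) - xstar‖ ≤ c * e n ^ (1 - θ) ∧ ‖y (n + 3) - xstar‖ ≤ c * e n ^ (1 - θ) ∧
        ‖z (n + 3) - xstar‖ ≤ c * e n ^ (1 - θ) := by
  have htop : f xstar ≠ ⊤ := by
    obtain ⟨v, hv, -⟩ := hKL.1
    intro hf
    rw [objective, hf, EReal.top_add_coe] at hv
    exact lt_irrefl _ hv
  obtain ⟨C, D, hC, hD, N₀, e, he, he0, helim, hedesc, hdlim, hFlim⟩ :=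
    h.exists_energy hfg hs hk hy hz hα hβ hstep hbdd hx htop
  obtain ⟨K, ε, η, hK, hε, hη, hKLr⟩ := hKL.exists_real (objective_eq_coe hfg htop)
  obtain ⟨A, hAα, hAβ⟩ : ∃ A : ℝ, (∀ n, |α n| ≤ A) ∧ ∀ n, |β n| ≤ A := by
    obtain ⟨A₁, hA₁⟩ := hα.abs.bddAbove_range
    obtain ⟨A₂, hA₂⟩ := hβ.abs.bddAbove_range
    exact ⟨max A₁ A₂, fun n => (hA₁ ⟨n, rfl⟩).trans (le_max_left _ _),
      fun n => (hA₂ ⟨n, rfl⟩).trans (le_max_right _ _)⟩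
  have hA : 0 ≤ A := (abs_nonneg _).trans (hAα 0)
  obtain ⟨W, hW, hWdef⟩ : ∃ W : ℝ, 0 < W ∧ W = (L + s⁻¹) * (1 + A) :=
    ⟨_, by positivity, rfl⟩
  have hev : ∀ᶠ n in atTop, ‖x (n + 1) - x n‖ ≤ 1 ∧
      realObjective f g (x (n + 1)) < realObjective f g xstar + η :=
    (hdlim.eventually_le_const zero_lt_one).and (hFlim.eventually_lt_const (by linarith))
  obtain ⟨N₁, hN₁⟩ := eventually_atTop.1 hev
  have hθ0 : 0 ≤ θ := le_trans (by norm_num) hθ.1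
  have hKLe : ∀ n, max N₀ N₁ ≤ n → ‖x (n + 2) - xstar‖ ≤ ε →
      e (n + 1) ^ θ ≤ (K * W + C ^ θ) * (‖x (n + 1) - x n‖ + ‖x (n + 2) - x (n + 1)‖) := by
    intro n hn hball
    obtain ⟨hd1, hFη⟩ := hN₁ (n + 1) (by have := le_max_right N₀ N₁; omega)
    have hd1' : ‖x (n + 2) - x (n + 1)‖ ≤ 1 := hd1
    set t := realObjective f g (x (n + 2)) - realObjective f g xstar with ht
    set d := ‖x (n + 2) - x (n + 1)‖ with hd
    have hd0 : 0 ≤ d := norm_nonneg _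
    -- Only the energy is known to be nonnegative: `F` may fall below `F xstar`, where KL says
    -- nothing, hence the truncation.
    have hsub : max t 0 ^ θ ≤ K * (W * (‖x (n + 1) - x n‖ + d)) := by
      rcases le_or_gt t 0 with htn | htp
      · rw [max_eq_right htn, Real.zero_rpow (by linarith [hθ.1])]
        positivity
      · rw [max_eq_left htp.le]
        refine (hKLr (x (n + 2)) _ _ (objective_eq_coe hfg (h.ne_top (n + 1))) hball
          (by linarith) hFη (h.mem_frechetSubdiff hfg hs hk (n + 1))).trans ?_
        gcongr
        rw [hWdef]
        exact norm_subgradient_le hfg hs hy hz hAα hAβ n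
    have hquad : (C * d ^ 2) ^ θ ≤ C ^ θ * d := by
      rw [Real.mul_rpow hC.le (sq_nonneg _), ← Real.rpow_natCast, ← Real.rpow_mul hd0]
      gcongr
      calc d ^ (((2 : ℕ) : ℝ) * θ) ≤ d ^ (1 : ℝ) :=
            Real.rpow_le_rpow_of_exponent_ge' hd0 hd1' zero_le_one
              (by push_cast; linarith [hθ.1])
        _ = d := Real.rpow_one d
    have hen : e (n + 1) = t + C * d ^ 2 := he (n + 1)
    have hen0 : 0 ≤ e (n + 1) := he0 _ (by have := le_max_left N₀ N₁; omega)
    calc e (n + 1) ^ θ ≤ (max t 0 + C * d ^ 2) ^ θ := by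
          rw [hen] at hen0 ⊢
          gcongr
          exact le_max_left _ _
      _ ≤ max t 0 ^ θ + (C * d ^ 2) ^ θ :=
          Real.rpow_add_le_add_rpow (le_max_right _ _) (by positivity) hθ0 hθ.2.le
      _ ≤ K * (W * (‖x (n + 1) - x n‖ + d)) + C ^ θ * (‖x (n + 1) - x n‖ + d) := by
          refine add_le_add hsub (hquad.trans ?_)
          gcongr
          linarith [norm_nonneg (x (n + 1) - x n)]
      _ = _ := by ring
  obtain ⟨κ, c, hκ, hc, N, hNN, hrate⟩ := exists_rate_of_descent (N := max N₀ N₁) hD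
    (by positivity : 0 < K * W + C ^ θ) hε hθ
    (fun n hn => he0 n (le_trans (le_max_left _ _) hn)) helim
    (fun n hn => hedesc n (le_trans (le_max_left _ _) hn)) hKLe hx
  have hN₀ : N₀ ≤ N := le_trans (le_max_left _ _) hNN
  have hmono : ∀ n, N ≤ n → e (n + 1) ≤ e n := fun n hn => by
    have h1 := (hrate n hn).1
    have h2 := Real.rpow_nonneg (he0 (n + 1) (by omega)) (2 * θ)
    have h3 := mul_nonneg hκ.le h2
    linarith
  refine ⟨κ, (1 + 2 * A) * c, hκ, by positivity, e, N, helim, fun n hn => he0 n (by omega),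
    fun n hn => (hrate n hn).1, fun n hn => ?_⟩
  -- `y (n + 3)` and `z (n + 3)` involve both `x (n + 3)` and `x (n + 2)`; this forces the shift by
  -- 3.
  have hr0 : ‖x (n + 2) - xstar‖ ≤ c * e n ^ (1 - θ) := (hrate n hn).2
  have hr1 : ‖x (n + 3) - xstar‖ ≤ c * e n ^ (1 - θ) := by
    refine ((hrate (n + 1) (by omega)).2).trans ?_
    gcongr
    · exact he0 _ (by omega)
    · linarith [hθ.2]
    · exact hmono n hn
  have hr0' : 0 ≤ c * e n ^ (1 - θ) := (norm_nonneg _).trans hr0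
  refine ⟨?_, ?_, ?_, ?_⟩
  · rw [objective_eq_coe hfg (h.ne_top (n + 2)), objective_eq_coe hfg htop, ← EReal.coe_sub,
      EReal.coe_le_coe_iff]
    have h1 := he (n + 2)
    have h2 := hmono n hn
    have h3 := hmono (n + 1) (by omega)
    have h4 : 0 ≤ C * ‖x (n + 2 + 1) - x (n + 2)‖ ^ 2 := by positivity
    have h5 : e (n + 2) = e (n + 1 + 1) := rfl
    linarith
  · rw [mul_assoc]
    nlinarith
  · rw [mul_assoc, hy]
    exact norm_inertialStep_sub_le_of_le (hAα _) hr0 hr1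
  · rw [mul_assoc, hz]
    exact norm_inertialStep_sub_le_of_le (hAβ _) hr0 hr1

/-- Absorbs the index shift into a constant, as `n + 3 ≤ 4 n`. -/
theorem rpow_neg_le_shift {n : ℕ} {q : ℝ} (hn : 1 ≤ n) (hq : 0 ≤ q) :
    (n : ℝ) ^ (-q) ≤ 4 ^ q * ((n + 3 : ℕ) : ℝ) ^ (-q) := by
  have hn0 : (0 : ℝ) < n := by exact_mod_cast hn
  have h3 : ((n + 3 : ℕ) : ℝ) ≤ 4 * n := by exact_mod_cast (by omega : n + 3 ≤ 4 * n)
  have h30 : (0 : ℝ) < ((n + 3 : ℕ) : ℝ) := by positivity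
  rw [Real.rpow_neg hn0.le, Real.rpow_neg h30.le, ← div_eq_mul_inv, le_div_iff₀ (by positivity),
    ← div_eq_inv_mul, div_le_iff₀ (by positivity), ← Real.mul_rpow (by norm_num) hn0.le]
  gcongr

end Convergence

end Padisno

/-! ### The explicit rates. -/

theorem mainTheorem8 {m : ℕ}
    (f : EuclideanSpace ℝ (Fin m) → EReal) (g : EuclideanSpace ℝ (Fin m) → ℝ) (L : ℝ≥0)
    (hfg : Padisno.IsProblem f g L)
    (α β : ℕ → ℝ) (s : ℝ) (x y z : ℕ → EuclideanSpace ℝ (Fin m))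
    (hxyz : Padisno.IsPADISNO f g L α β s x y z ∨ Padisno.IsConvexPADISNO f g L α β s x y z)
    (hbdd : Padisno.BoundedFromBelow (Padisno.objective f g))
    (xstar : EuclideanSpace ℝ (Fin m)) (hxstar : Padisno.IsSeqClusterPt x xstar)
    (θ : ℝ) (hθ : θ ∈ Set.Ico (1 / 2 : ℝ) 1)
    (hKL : Padisno.HasKLExponentAt (Padisno.objective f g) xstar θ) :
    (θ = 1 / 2 →
      ∃ a₁ : ℝ, 0 < a₁ ∧ ∃ Q ∈ Set.Ico (0 : ℝ) 1, ∃ N : ℕ, ∀ n ≥ N,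
        Padisno.objective f g (x n) - Padisno.objective f g xstar ≤ ((a₁ * Q ^ n : ℝ) : EReal) ∧
        ‖x n - xstar‖ ≤ a₁ * Q ^ ((n : ℝ) / 2) ∧
        ‖y n - xstar‖ ≤ a₁ * Q ^ ((n : ℝ) / 2) ∧
        ‖z n - xstar‖ ≤ a₁ * Q ^ ((n : ℝ) / 2)) ∧
    (θ ∈ Set.Ioo (1 / 2 : ℝ) 1 →
      ∃ a₂ : ℝ, 0 < a₂ ∧ ∃ N : ℕ, ∀ n ≥ N,
        Padisno.objective f g (x n) - Padisno.objective f g xstar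
          ≤ ((a₂ * (n : ℝ) ^ (-(1 / (2 * θ - 1))) : ℝ) : EReal) ∧
        ‖x n - xstar‖ ≤ a₂ * (n : ℝ) ^ ((θ - 1) / (2 * θ - 1)) ∧
        ‖y n - xstar‖ ≤ a₂ * (n : ℝ) ^ ((θ - 1) / (2 * θ - 1)) ∧
        ‖z n - xstar‖ ≤ a₂ * (n : ℝ) ^ ((θ - 1) / (2 * θ - 1))) := by
  have hrate : ∃ κ c : ℝ, 0 < κ ∧ 0 < c ∧ ∃ e : ℕ → ℝ, ∃ N : ℕ, Tendsto e atTop (𝓝 0) ∧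
      (∀ n, N ≤ n → 0 ≤ e n) ∧ (∀ n, N ≤ n → e (n + 1) + κ * e (n + 1) ^ (2 * θ) ≤ e n) ∧
      ∀ n, N ≤ n →
        Padisno.objective f g (x (n + 3)) - Padisno.objective f g xstar ≤ (e n : EReal) ∧
        ‖x (n + 3) - xstar‖ ≤ c * e n ^ (1 - θ) ∧ ‖y (n + 3) - xstar‖ ≤ c * e n ^ (1 - θ) ∧
        ‖z (n + 3) - xstar‖ ≤ c * e n ^ (1 - θ) := by
    rcases hxyz with h | h
    · obtain ⟨a, b, hα, hβ, -, hs, hst⟩ := h.parameters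
      exact (h.isProximalStep hfg).exists_rate hfg hs le_rfl h.y_eq h.z_eq hα hβ
        (by linarith) hbdd hxstar hθ hKL
    · obtain ⟨a, b, hα, hβ, -, hs, hst⟩ := h.parameters
      exact (h.isProximalStep hfg hs).exists_rate hfg hs one_le_two h.y_eq h.z_eq hα hβ
        (by linarith) hbdd hxstar hθ hKL
  obtain ⟨κ, c, hκ, hc, e, N, helim, he0, hestep, hbound⟩ := hrate
  constructor
  · rintro rfl
    obtain ⟨C, hC, hCle⟩ := Padisno.exists_le_geometric hκ he0 (fun n hn => by
      have := hestep n hn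
      norm_num at this
      exact this)
    set Q : ℝ := 1 / (1 + κ) with hQ
    have hQ0 : 0 < Q := by positivity
    have hQ1 : Q < 1 := by rw [hQ, div_lt_one (by positivity)]; linarith
    -- One constant serves both the value bound and the distance bounds; `Q⁻¹ ^ 3` undoes the index
    -- shift.
    set a₁ : ℝ := C * Q⁻¹ ^ 3 + c * (C * Q⁻¹ ^ 3) ^ (1 / 2 : ℝ) with ha₁
    refine ⟨a₁, by positivity, Q, ⟨hQ0.le, hQ1⟩, N + 3, fun n hn => ?_⟩
    obtain ⟨j, rfl⟩ : ∃ j, n = j + 3 := ⟨n - 3, by omega⟩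
    have hj : N ≤ j := by omega
    obtain ⟨h1, h2, h3, h4⟩ := hbound j hj
    have hej : e j ≤ C * Q⁻¹ ^ 3 * Q ^ (j + 3) := by
      refine (hCle j hj).trans (le_of_eq ?_)
      rw [pow_add]; field_simp
    have hroot : c * e j ^ (1 - 1 / 2 : ℝ) ≤ a₁ * Q ^ (((j + 3 : ℕ) : ℝ) / 2) := by
      calc c * e j ^ (1 - 1 / 2 : ℝ) ≤ c * (C * Q⁻¹ ^ 3 * Q ^ (j + 3)) ^ (1 / 2 : ℝ) := by
            rw [show (1 - 1 / 2 : ℝ) = 1 / 2 by norm_num]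
            have := he0 j hj
            gcongr
        _ = c * (C * Q⁻¹ ^ 3) ^ (1 / 2 : ℝ) * Q ^ (((j + 3 : ℕ) : ℝ) / 2) := by
            rw [Real.mul_rpow (by positivity) (by positivity), ← Real.rpow_natCast Q (j + 3),
              ← Real.rpow_mul hQ0.le, mul_one_div, mul_assoc]
        _ ≤ a₁ * Q ^ (((j + 3 : ℕ) : ℝ) / 2) := by
            gcongr
            rw [ha₁]
            linarith [show 0 < C * Q⁻¹ ^ 3 by positivity]
    refine ⟨h1.trans (EReal.coe_le_coe_iff.2 (hej.trans ?_)), h2.trans hroot, h3.trans hroot,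
      h4.trans hroot⟩
    gcongr
    rw [ha₁]
    linarith [show 0 < c * (C * Q⁻¹ ^ 3) ^ (1 / 2 : ℝ) by positivity]
  · rintro ⟨hθ1, hθ2⟩
    have hq : 0 < 2 * θ - 1 := by linarith
    obtain ⟨C, hC, N', hCle⟩ := Padisno.exists_le_rpow_neg hκ hq he0 helim (fun n hn => by
      have := hestep n hn
      rwa [show 1 + (2 * θ - 1) = 2 * θ by ring])
    set q : ℝ := 1 / (2 * θ - 1) with hqdef
    have hq0 : 0 < q := by positivity
    have h1θ : 0 < 1 - θ := by linarith
    set a₂ : ℝ := C * 4 ^ q + c * (C * 4 ^ q) ^ (1 - θ) with ha₂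
    -- The 4 makes `j = n - 3` at least 1, as the shift of negative powers requires.
    refine ⟨a₂, by positivity, max N N' + 4, fun n hn => ?_⟩
    obtain ⟨j, rfl⟩ : ∃ j, n = j + 3 := ⟨n - 3, by omega⟩
    have hj : N ≤ j := by have := le_max_left N N'; omega
    have hj' : N' ≤ j := by have := le_max_right N N'; omega
    obtain ⟨h1, h2, h3, h4⟩ := hbound j hj
    have hej : e j ≤ C * 4 ^ q * ((j + 3 : ℕ) : ℝ) ^ (-q) := by
      rw [mul_assoc]
      refine (hCle j hj').trans ?_
      gcongr
      exact Padisno.rpow_neg_le_shift (by omega) hq0.le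
    have hroot : c * e j ^ (1 - θ) ≤ a₂ * ((j + 3 : ℕ) : ℝ) ^ ((θ - 1) / (2 * θ - 1)) := by
      calc c * e j ^ (1 - θ) ≤ c * (C * 4 ^ q * ((j + 3 : ℕ) : ℝ) ^ (-q)) ^ (1 - θ) := by
            have := he0 j hj
            gcongr
        _ = c * (C * 4 ^ q) ^ (1 - θ) * ((j + 3 : ℕ) : ℝ) ^ ((θ - 1) / (2 * θ - 1)) := by
            rw [Real.mul_rpow (by positivity) (by positivity), ← Real.rpow_mul (by positivity),
              show -q * (1 - θ) = (θ - 1) / (2 * θ - 1) by rw [hqdef]; ring, mul_assoc]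
        _ ≤ a₂ * ((j + 3 : ℕ) : ℝ) ^ ((θ - 1) / (2 * θ - 1)) := by
            gcongr
            rw [ha₂]
            linarith [show 0 < C * 4 ^ q by positivity]
    refine ⟨h1.trans (EReal.coe_le_coe_iff.2 (hej.trans ?_)), h2.trans hroot, h3.trans hroot,
      h4.trans hroot⟩
    gcongr
    rw [ha₂]
    linarith [show 0 < c * (C * 4 ^ q) ^ (1 - θ) by positivity]
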